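/- Let $X$ and $Y$ be real Banach spaces. A sequence $(x_n)_{n\in\mathbb N}$ in $X$ is a basis of $X$ if every $v\in X$ has a unique expansion $v=\sum_n a(n)x_n$ with $a\in\mathbb R^{\mathbb N}$ (norm convergence of the partial sums); a basis is unconditional if $(x_{\pi(n)})$ is a basis of $X$ for every permutation $\pi$ of $\mathbb N$. A subsequence $(y_{n_k})$ (with $n_0<n_1<\cdots$) of a basis of $Y$ is called conditional if it is not an unconditional basis of its closed linear span. For a sequence $(x_n)$ in $X$ let $E(X,(x_n))$ be the equivalence relation on $\mathbb R^{\mathbb N}$ given by $$(a,b)\in E(X,(x_n))\iff \sum_n (a(n)-b(n))x_n \text{ converges in } X .$$ For equivalence relations $E,F$ on Polish spaces $P,Q$, $E$ is Borel reducible to $F$ if there is a Borel function $\theta:P\to Q$ with $(a,b)\in E\iff(\theta(a),\theta(b))\in F$ for all $a,b\in P$. Theorem. Let $(x_n)$ be an unconditional basis of $X$ and let $(y_n)$ be a basis of $Y$ every subsequence of which is conditional. Then $E(Y,(y_n))$ is not Borel reducible to $E(X,(x_n))$. -/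

import Mathlib

open Filter Topology

/-- The series `∑ₙ a(n) xₙ` converges in norm to `v`, i.e. its partial sums do. -/
def SeriesConvergesTo {X : Type*} [NormedAddCommGroup X] [NormedSpace ℝ X]
    (x : ℕ → X) (a : ℕ → ℝ) (v : X) : Prop :=
  Tendsto (fun N : ℕ => ∑ n ∈ Finset.range N, a n • x n) atTop (𝓝 v)

/-- `(xₙ)` is a (Schauder) basis of `X`: every `v : X` has a unique expansion `v = ∑ₙ a(n) xₙ`. -/
def IsBasisOfSpace {X : Type*} [NormedAddCommGroup X] [NormedSpace ℝ X] (x : ℕ → X) : Prop :=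
  ∀ v : X, ∃! a : ℕ → ℝ, SeriesConvergesTo x a v

/-- `(xₙ)` is an unconditional basis of `X`: for every permutation `π` of `ℕ`, the sequence
`(x_{π(n)})` is a basis of `X`  (with `π = id`, so is `(xₙ)` itself). -/
def IsUnconditionalBasisOfSpace {X : Type*} [NormedAddCommGroup X] [NormedSpace ℝ X]
    (x : ℕ → X) : Prop :=
  ∀ π : Equiv.Perm ℕ, IsBasisOfSpace (fun n => x (π n))

/-- The closed linear span of the terms of a sequence. -/
def closedSpan {X : Type*} [NormedAddCommGroup X] [NormedSpace ℝ X] (x : ℕ → X) :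
    Submodule ℝ X :=
  (Submodule.span ℝ (Set.range x)).topologicalClosure

/-- A sequence, regarded as a sequence of elements of its closed linear span. -/
def inClosedSpan {X : Type*} [NormedAddCommGroup X] [NormedSpace ℝ X] (x : ℕ → X) (n : ℕ) :
    closedSpan x :=
  ⟨x n, Submodule.le_topologicalClosure _ (Submodule.subset_span (Set.mem_range_self n))⟩

/-- `(xₙ)` is an unconditional basic sequence: an unconditional basis of its closed linear span. -/
def IsUnconditionalBasicSeq {X : Type*} [NormedAddCommGroup X] [NormedSpace ℝ X]
    (x : ℕ → X) : Prop :=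
  IsUnconditionalBasisOfSpace (inClosedSpan x)

/-- `coef(X, (xₙ))`: the linear space of all `a : ℕ → ℝ` such that `∑ₙ a(n) xₙ` converges in `X`. -/
def coef {X : Type*} [NormedAddCommGroup X] [NormedSpace ℝ X] (x : ℕ → X) :
    Submodule ℝ (ℕ → ℝ) where
  carrier := {a | ∃ v : X, SeriesConvergesTo x a v}
  zero_mem' := ⟨0, by simp [SeriesConvergesTo]⟩
  add_mem' := by
    rintro a b ⟨v, hv⟩ ⟨w, hw⟩
    refine ⟨v + w, ?_⟩
    simpa [SeriesConvergesTo, add_smul, Finset.sum_add_distrib] using Tendsto.add hv hw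
  smul_mem' := by
    rintro c a ⟨v, hv⟩
    refine ⟨c • v, ?_⟩
    simpa [SeriesConvergesTo, mul_smul, Finset.smul_sum] using Tendsto.const_smul hv c

/-- The equivalence relation `E(X, (xₙ)) = ℝ^ℕ / coef(X, (xₙ))` on `ℝ^ℕ`. -/
def schauderEquiv {X : Type*} [NormedAddCommGroup X] [NormedSpace ℝ X] (x : ℕ → X) :
    Setoid (ℕ → ℝ) where
  r a b := a - b ∈ coef x
  iseqv :=
    { refl := fun a => by simp
      symm := fun {a b} h => by simpa using (coef x).neg_mem h
      trans := fun {a b c} h h' => by simpa using (coef x).add_mem h h' }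

/-- `E ≤_B F`: there is a Borel function `θ` with `a E b ↔ θ(a) F θ(b)` for all `a`, `b`. -/
def BorelReducible {α β : Type*}
    [TopologicalSpace α] [PolishSpace α] [MeasurableSpace α] [BorelSpace α]
    [TopologicalSpace β] [PolishSpace β] [MeasurableSpace β] [BorelSpace β]
    (E : Setoid α) (F : Setoid β) : Prop :=
  ∃ θ : α → β, Measurable θ ∧ ∀ a b : α, E a b ↔ F (θ a) (θ b)

/-! ### Schauder bases: coordinates and unconditional convergence. -/

section Banach

variable {X : Type*} [NormedAddCommGroup X] [NormedSpace ℝ X]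

/-! Suppose `θ` is a Borel reduction. Restrict it to a product of finite grids, giving `Θ = θ ∘
gridPoint`, which is continuous on a comeager set. Changing finitely many coordinates of the input
changes `Θ` by an element of `coef x`. A Baire category fusion then fixes all input coordinates
except an infinite set `φ 0 < φ 1 < ⋯` and cuts the output into blocks, the `i`-th of which depends,
up to a geometrically small error, only on input coordinate `φ i` (`exists_block_decomposition`).
Let `w`, `w'` be such inputs with `Θ w - Θ w' ∈ coef x`, and let `v` follow `w` on `A` and `w'` off
`A`. Up to a convergent series, `Θ v - Θ w'` is `Θ w - Θ w'` restricted to a set of blocks.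
Unconditionality of `x` puts it in `coef x` (`exists_mixing_subsequence`), and the reduction carries
this back to `y`. Every `c ∈ coef y` supported on the range of `φ` is such a grid difference up to
an absolutely convergent error (`exists_gridPoint_sub_approx`). Hence all its subseries converge, so
it is summable, and `y ∘ φ` is an unconditional basic sequence, a contradiction. -/

theorem IsBasisOfSpace.eq_zero {x : ℕ → X} (hx : IsBasisOfSpace x) {a : ℕ → ℝ}
    (ha : SeriesConvergesTo x a 0) : a = 0 :=
  (hx 0).unique ha (by simp [SeriesConvergesTo])

theorem IsBasisOfSpace.ne_zero {x : ℕ → X} (hx : IsBasisOfSpace x) (n : ℕ) : x n ≠ 0 := by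
  intro h
  have h1 : SeriesConvergesTo x (Pi.single n 1) 0 := by
    have : ∀ N : ℕ, ∑ k ∈ Finset.range N, (Pi.single n 1 : ℕ → ℝ) k • x k = 0 := fun N =>
      Finset.sum_eq_zero fun k _ => by
        by_cases hk : k = n
        · simp [hk, h]
        · simp [hk]
    simp [SeriesConvergesTo, this]
  simpa using congrFun (hx.eq_zero h1) n

/-- The closed space of convergent sequences `s` with `s 0 = 0` and increments along `x`. -/
def partialSumSpace (x : ℕ → X) : Submodule ℝ C(OnePoint ℕ, X) where
  carrier := {s | s (0 : ℕ) = 0 ∧ ∀ n : ℕ, s (n + 1 : ℕ) - s n ∈ Submodule.span ℝ {x n}}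
  zero_mem' := by simp
  add_mem' := by
    rintro s t ⟨hs0, hs⟩ ⟨ht0, ht⟩
    refine ⟨by simp [hs0, ht0], fun n => ?_⟩
    convert (Submodule.span ℝ {x n}).add_mem (hs n) (ht n) using 1
    simp only [ContinuousMap.add_apply]
    abel
  smul_mem' := by
    rintro c s ⟨hs0, hs⟩
    refine ⟨by simp [hs0], fun n => ?_⟩
    convert (Submodule.span ℝ {x n}).smul_mem c (hs n) using 1
    simp only [ContinuousMap.smul_apply, smul_sub]

theorem isClosed_partialSumSpace (x : ℕ → X) :
    IsClosed (partialSumSpace x : Set C(OnePoint ℕ, X)) := by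
  have : (partialSumSpace x : Set C(OnePoint ℕ, X)) =
      {s | s (0 : ℕ) = 0} ∩ ⋂ n : ℕ, {s | s (n + 1 : ℕ) - s n ∈ Submodule.span ℝ {x n}} := by
    ext s
    simp [partialSumSpace]
  rw [this]
  refine (isClosed_eq (by fun_prop) (by fun_prop)).inter (isClosed_iInter fun n => ?_)
  have hc : IsClosed (Submodule.span ℝ {x n} : Set X) := Submodule.closed_of_finiteDimensional _
  exact hc.preimage (f := fun s : C(OnePoint ℕ, X) => s (n + 1 : ℕ) - s n) (by fun_prop)

theorem exists_coeff_of_mem_partialSumSpace {x : ℕ → X} {s : C(OnePoint ℕ, X)}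
    (hs : s ∈ partialSumSpace x) :
    ∃ a : ℕ → ℝ, (∀ N : ℕ, s N = ∑ n ∈ Finset.range N, a n • x n) ∧
      SeriesConvergesTo x a (s OnePoint.infty) := by
  choose a ha using fun n => Submodule.mem_span_singleton.1 (hs.2 n)
  have h : ∀ N : ℕ, s N = ∑ n ∈ Finset.range N, a n • x n := by
    intro N
    induction N with
    | zero => simpa using hs.1
    | succ N ih => rw [Finset.sum_range_succ, ← ih, ha]; abel
  refine ⟨a, h, ?_⟩
  have : Tendsto (fun N : ℕ => s (N : OnePoint ℕ)) atTop (𝓝 (s OnePoint.infty)) := by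
    rw [← Nat.cofinite_eq_atTop]
    exact (OnePoint.continuous_iff_from_discrete _).1 s.continuous
  exact this.congr h

theorem SeriesConvergesTo.exists_mem_partialSumSpace {x : ℕ → X} {a : ℕ → ℝ} {v : X}
    (h : SeriesConvergesTo x a v) :
    ∃ s ∈ partialSumSpace x, s OnePoint.infty = v ∧
      ∀ N : ℕ, s N = ∑ n ∈ Finset.range N, a n • x n := by
  refine ⟨OnePoint.continuousMapMkNat _ v h, ⟨?_, fun n => ?_⟩, rfl, fun N => rfl⟩
  · change ∑ n ∈ Finset.range 0, a n • x n = 0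
    simp
  · change ∑ n ∈ Finset.range (n + 1), a n • x n - ∑ n ∈ Finset.range n, a n • x n ∈ _
    rw [Finset.sum_range_succ, add_sub_cancel_left]
    exact Submodule.smul_mem _ _ (Submodule.mem_span_singleton_self _)

/-- Banach's theorem: the coefficient functionals of a Schauder basis are continuous. -/
theorem IsBasisOfSpace.exists_coord [CompleteSpace X] {x : ℕ → X} (hx : IsBasisOfSpace x) :
    ∃ e : ℕ → X →L[ℝ] ℝ, ∀ a v, SeriesConvergesTo x a v → ∀ n, e n v = a n := by
  have : CompleteSpace (partialSumSpace x) :=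
    (isClosed_partialSumSpace x).completeSpace_coe
  let ev (p : OnePoint ℕ) : C(OnePoint ℕ, X) →L[ℝ] X := ContinuousMap.evalCLM ℝ p
  -- The limit map is injective by uniqueness of expansions and onto by their existence. The open
  -- mapping theorem makes its inverse continuous, and coordinates are increments of that inverse.
  let L : partialSumSpace x →L[ℝ] X := (ev OnePoint.infty).comp (partialSumSpace x).subtypeL
  have hL : ∀ s, L s = s.1 OnePoint.infty := fun s => rfl
  have hinj : L.ker = ⊥ := by
    rw [LinearMap.ker_eq_bot']
    rintro ⟨s, hs⟩ h
    change s OnePoint.infty = 0 at h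
    obtain ⟨a, ha, hav⟩ := exists_coeff_of_mem_partialSumSpace hs
    rw [h] at hav
    have ha0 := hx.eq_zero hav
    ext p
    induction p using OnePoint.rec with
    | infty => simpa using h
    | coe N => simp [ha, ha0]
  have hsurj : L.range = ⊤ := by
    rw [LinearMap.range_eq_top]
    intro v
    obtain ⟨a, ha, -⟩ := hx v
    obtain ⟨s, hs, hsv, -⟩ := ha.exists_mem_partialSumSpace
    exact ⟨⟨s, hs⟩, hsv⟩
  let T := ContinuousLinearEquiv.ofBijective L hinj hsurj
  choose g hg using fun n => SeparatingDual.exists_eq_one (R := ℝ) (hx.ne_zero n)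
  refine ⟨fun n => (g n).comp (((ev (n + 1 : ℕ) - ev n).comp (partialSumSpace x).subtypeL).comp
    (T.symm : X →L[ℝ] partialSumSpace x)), fun a v hav n => ?_⟩
  obtain ⟨s, hs, hsv, hsN⟩ := hav.exists_mem_partialSumSpace
  have hT : T.symm v = ⟨s, hs⟩ := by
    rw [ContinuousLinearEquiv.symm_apply_eq]
    exact hsv.symm
  change g n ((T.symm v).1 (n + 1 : ℕ) - (T.symm v).1 n) = a n
  rw [hT]
  simp only [hsN, Finset.sum_range_succ, add_sub_cancel_left, map_smul, hg, smul_eq_mul, mul_one]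

theorem apply_eq_ite_of_coord {x : ℕ → X} {e : ℕ → X →L[ℝ] ℝ}
    (he : ∀ a v, SeriesConvergesTo x a v → ∀ n, e n v = a n) (m n : ℕ) :
    e m (x n) = if n = m then 1 else 0 := by
  have : SeriesConvergesTo x (Pi.single n 1) (x n) := by
    refine tendsto_const_nhds.congr' ?_
    filter_upwards [eventually_gt_atTop n] with N hN
    rw [Finset.sum_eq_single n (fun k _ hk => by simp [hk]) (by simp [hN])]
    simp
  rw [he _ _ this, Pi.single_apply]
  simp [eq_comm]

/-! ### Cauchy criterion, rearrangements and subseries. -/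

theorem mem_coef_iff [CompleteSpace X] {x : ℕ → X} {a : ℕ → ℝ} :
    a ∈ coef x ↔ ∀ ε > 0, ∃ N, ∀ p q, N ≤ p → p ≤ q → ‖∑ n ∈ Finset.Ico p q, a n • x n‖ < ε := by
  have h0 : a ∈ coef x ↔ CauchySeq fun N : ℕ => ∑ n ∈ Finset.range N, a n • x n :=
    ⟨fun ⟨_, h⟩ => h.cauchySeq, cauchySeq_tendsto_of_complete⟩
  rw [h0, Metric.cauchySeq_iff]
  refine forall₂_congr fun ε _ => exists_congr fun N => ⟨fun h p q hp hpq => ?_, fun h p hp q hq => ?_⟩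
  · rw [Finset.sum_Ico_eq_sub _ hpq, ← dist_eq_norm]
    exact h q (hp.trans hpq) p hp
  · rcases le_total p q with hpq | hpq
    · rw [dist_comm, dist_eq_norm, ← Finset.sum_Ico_eq_sub _ hpq]
      exact h p q hp hpq
    · rw [dist_eq_norm, ← Finset.sum_Ico_eq_sub _ hpq]
      exact h q p hq hpq

theorem mem_coef_of_summable {x : ℕ → X} {a : ℕ → ℝ} (h : Summable fun n => a n • x n) :
    a ∈ coef x :=
  ⟨_, h.hasSum.tendsto_sum_nat⟩

/-- A non-summable family has successive finite blocks whose sums are bounded away from zero. -/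
theorem exists_blocks_of_not_summable {E : Type*} [NormedAddCommGroup E] [CompleteSpace E]
    {f : ℕ → E} (hf : ¬ Summable f) :
    ∃ ε > 0, ∃ p : ℕ → ℕ, StrictMono p ∧ ∃ T : ℕ → Finset ℕ,
      (∀ k, T k ⊆ Finset.Ico (p k) (p (k + 1))) ∧ ∀ k, ε ≤ ‖∑ n ∈ T k, f n‖ := by
  rw [summable_iff_vanishing_norm] at hf
  push Not at hf
  obtain ⟨ε, hε, h⟩ := hf
  have h1 : ∀ N : ℕ, ∃ T : Finset ℕ, ∃ M, N < M ∧ T ⊆ Finset.Ico N M ∧ ε ≤ ‖∑ n ∈ T, f n‖ := by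
    intro N
    obtain ⟨T, hT, hTε⟩ := h (Finset.range N)
    refine ⟨T, max (N + 1) (T.sup id + 1), by omega, fun n hn => ?_, hTε⟩
    have hn1 : n ≤ T.sup id := Finset.le_sup (f := id) hn
    have hn2 : n ∉ Finset.range N := Finset.disjoint_left.1 hT hn
    simp only [Finset.mem_range, Finset.mem_Ico] at *
    omega
  choose T M hM hT hTε using h1
  let p : ℕ → ℕ := fun k => M^[k] 0
  have hp : ∀ k, p (k + 1) = M (p k) := fun k => Function.iterate_succ_apply' M k 0
  refine ⟨ε, hε, p, strictMono_nat_of_lt_succ fun k => by rw [hp]; exact hM _,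
    fun k => T (p k), fun k => ?_, fun k => hTε _⟩
  rw [hp]
  exact hT _

/-- Index of the block containing a natural number. -/
theorem exists_blockIndex {p : ℕ → ℕ} (hp : StrictMono p) :
    ∃ β : ℕ → ℕ, ∀ n k, n ∈ Finset.Ico (p k) (p (k + 1)) → β n = k := by
  refine ⟨fun n => Nat.findGreatest (fun k => p k ≤ n) n, fun n k hn => ?_⟩
  rw [Finset.mem_Ico] at hn
  have hk : k ≤ n := (hp.id_le k).trans hn.1
  refine le_antisymm ?_ (Nat.le_findGreatest hk hn.1)
  have h := Nat.findGreatest_spec (P := fun k => p k ≤ n) hk hn.1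
  by_contra hlt
  push Not at hlt
  exact absurd (hp.monotone (Nat.succ_le_of_lt hlt)) (by simp only [Nat.succ_eq_add_one]; omega)

/-- There is a permutation of `ℕ` moving each `T k` to the front of the `k`-th block. -/
theorem exists_perm_blocks {p : ℕ → ℕ} (hp : StrictMono p) {T : ℕ → Finset ℕ}
    (hT : ∀ k, T k ⊆ Finset.Ico (p k) (p (k + 1))) :
    ∃ π : Equiv.Perm ℕ, ∀ k, (Finset.Ico (p k) (p k + (T k).card)).map π.toEmbedding = T k := by
  obtain ⟨β, hβ⟩ := exists_blockIndex hp
  have hcard : ∀ k, p k + (T k).card ≤ p (k + 1) := fun k => by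
    have h1 := Finset.card_le_card (hT k)
    have h2 := (hp (Nat.lt_succ_self k)).le
    rw [Nat.card_Ico] at h1
    simp only [Nat.succ_eq_add_one] at h2
    omega
  have hfront : ∀ k, Finset.Ico (p k) (p k + (T k).card) ⊆ Finset.Ico (p k) (p (k + 1)) :=
    fun k => Finset.Ico_subset_Ico_right (hcard k)
  have hperm : ∀ k, ∃ σ : Equiv.Perm ℕ, (∀ n, n ∉ Finset.Ico (p k) (p (k + 1)) → σ n = n) ∧
      ∀ n ∈ Finset.Ico (p k) (p k + (T k).card), σ n ∈ T k := by
    intro k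
    let B := Finset.Ico (p k) (p (k + 1))
    let P : B → Prop := fun n => n.1 ∈ Finset.Ico (p k) (p k + (T k).card)
    let Q : B → Prop := fun n => n.1 ∈ T k
    -- The initial segment and `T k` have equal cardinality, so a bijection between them extends to
    -- a permutation of the finite block.
    have e : {n // P n} ≃ {n // Q n} := by
      refine ((Equiv.subtypeSubtypeEquivSubtype (fun {n} hn => hfront k hn)).trans ?_).trans
        (Equiv.subtypeSubtypeEquivSubtype (fun {n} hn => hT k hn)).symm
      exact Finset.equivOfCardEq (by simp)
    refine ⟨Equiv.Perm.ofSubtype e.extendSubtype, fun n hn => ?_, fun n hn => ?_⟩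
    · exact Equiv.Perm.ofSubtype_apply_of_not_mem _ hn
    · rw [Equiv.Perm.ofSubtype_apply_of_mem _ (hfront k hn)]
      exact e.extendSubtype_mem ⟨n, hfront k hn⟩ hn
  choose σ hσ hσT using hperm
  have hmem : ∀ k n, n ∈ Finset.Ico (p k) (p (k + 1)) → σ k n ∈ Finset.Ico (p k) (p (k + 1)) := by
    intro k n hn
    by_contra h
    exact h (by rwa [(σ k).injective (hσ k _ h)])
  have hβσ : ∀ n, β (σ (β n) n) = β n := by
    intro n
    by_cases hn : n ∈ Finset.Ico (p (β n)) (p (β n + 1))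
    · exact hβ _ _ (hmem _ _ hn)
    · rw [hσ _ _ hn]
  have hsymm : ∀ k n, n ∉ Finset.Ico (p k) (p (k + 1)) → (σ k).symm n = n := fun k n hn => by
    rw [Equiv.symm_apply_eq, hσ _ _ hn]
  have hβσ' : ∀ n, β ((σ (β n)).symm n) = β n := by
    intro n
    by_cases hn : n ∈ Finset.Ico (p (β n)) (p (β n + 1))
    · refine hβ _ _ ?_
      by_contra h
      have := hσ _ _ h
      rw [Equiv.apply_symm_apply] at this
      rw [← this] at h
      exact h hn
    · rw [hsymm _ _ hn]
  refine ⟨⟨fun n => σ (β n) n, fun n => (σ (β n)).symm n, fun n => by simp [hβσ],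
    fun n => by simp [hβσ']⟩, fun k => Finset.eq_of_subset_of_card_le ?_ (by simp)⟩
  intro m hm
  obtain ⟨n, hn, rfl⟩ := Finset.mem_map.1 hm
  change σ (β n) n ∈ T k
  rw [hβ n k (hfront k hn)]
  exact hσT k n hn

/-- Expansions with respect to an unconditional basis are summable. -/
theorem IsUnconditionalBasisOfSpace.summable [CompleteSpace X] {x : ℕ → X}
    (hx : IsUnconditionalBasisOfSpace x) {a : ℕ → ℝ} (ha : a ∈ coef x) :
    Summable fun n => a n • x n := by
  have hb : IsBasisOfSpace x := hx 1
  obtain ⟨e, he⟩ := hb.exists_coord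
  have he1 := apply_eq_ite_of_coord he
  obtain ⟨v, hv⟩ := ha
  have hperm : ∀ π : Equiv.Perm ℕ, (a ∘ π) ∈ coef (x ∘ π) := by
    intro π
    obtain ⟨b, hbv, -⟩ := hx π v
    -- Continuous coordinates force the rearranged expansion of `v` to have the rearranged
    -- coefficients.
    suffices a ∘ π = b by rw [this]; exact ⟨v, hbv⟩
    ext m
    have h1 : Tendsto (fun N => e (π m) (∑ n ∈ Finset.range N, b n • x (π n))) atTop
        (𝓝 (e (π m) v)) := ((e (π m)).continuous.tendsto _).comp hbv
    have h2 : Tendsto (fun N => e (π m) (∑ n ∈ Finset.range N, b n • x (π n))) atTop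
        (𝓝 (b m)) := by
      refine tendsto_const_nhds.congr' ?_
      filter_upwards [eventually_gt_atTop m] with N hN
      simp [he1, hN]
    rw [Function.comp_apply, ← he a v hv]
    exact tendsto_nhds_unique h1 h2
  by_contra hns
  obtain ⟨ε, hε, p, hp, T, hT, hTε⟩ := exists_blocks_of_not_summable hns
  obtain ⟨π, hπ⟩ := exists_perm_blocks hp hT
  obtain ⟨N, hN⟩ := mem_coef_iff.1 (hperm π) ε hε
  have h1 := hN (p N) (p N + (T N).card) (hp.id_le N) (by omega)
  have h2 := hTε N
  rw [← hπ N, Finset.sum_map] at h2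
  exact absurd h1 (not_lt.2 h2)

/-- If all subseries converge, the series is summable. -/
theorem summable_of_forall_indicator_mem_coef [CompleteSpace X] {x : ℕ → X} {a : ℕ → ℝ}
    (h : ∀ A : Set ℕ, A.indicator a ∈ coef x) : Summable fun n => a n • x n := by
  by_contra hns
  obtain ⟨ε, hε, p, hp, T, hT, hTε⟩ := exists_blocks_of_not_summable hns
  obtain ⟨N, hN⟩ := mem_coef_iff.1 (h (⋃ k, (T k : Set ℕ))) ε hε
  have h1 := hN (p N) (p (N + 1)) (hp.id_le N) (hp (Nat.lt_succ_self N)).le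
  refine absurd h1 (not_lt.2 ((hTε N).trans_eq ?_))
  congr 1
  obtain ⟨β, hβ⟩ := exists_blockIndex hp
  rw [← Finset.sum_subset (hT N)]
  · refine Finset.sum_congr rfl fun n hn => ?_
    rw [Set.indicator_of_mem (Set.mem_iUnion.2 ⟨N, hn⟩)]
  · intro n hn hnT
    rw [Set.indicator_of_notMem, zero_smul]
    rintro hmem
    obtain ⟨k, hk⟩ := Set.mem_iUnion.1 hmem
    have := (hβ n k (hT k hk)).symm.trans (hβ n N hn)
    subst this
    exact hnT hk

theorem IsUnconditionalBasisOfSpace.indicator_mem_coef [CompleteSpace X] {x : ℕ → X}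
    (hx : IsUnconditionalBasisOfSpace x) {a : ℕ → ℝ} (ha : a ∈ coef x) (A : Set ℕ) :
    A.indicator a ∈ coef x := by
  refine mem_coef_of_summable (((hx.summable ha).indicator A).congr fun n => ?_)
  by_cases hn : n ∈ A <;> simp [hn]

/-- A subsequence of a basis all of whose expansions are summable is an unconditional basic
sequence. -/
theorem IsBasisOfSpace.isUnconditionalBasicSeq_comp [CompleteSpace X] {y : ℕ → X}
    (hy : IsBasisOfSpace y) {φ : ℕ → ℕ} (hφ : StrictMono φ)
    (h : ∀ c ∈ coef y, (∀ n ∉ Set.range φ, c n = 0) → Summable fun n => c n • y n) :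
    IsUnconditionalBasicSeq fun k => y (φ k) := by
  intro π v
  obtain ⟨e, he⟩ := hy.exists_coord
  have he1 := apply_eq_ite_of_coord he
  have hcoe : ∀ b : ℕ → ℝ, SeriesConvergesTo
      (fun n => inClosedSpan (fun k => y (φ k)) (π n)) b v ↔
      Tendsto (fun N => ∑ n ∈ Finset.range N, b n • y (φ (π n))) atTop (𝓝 (v : X)) := by
    intro b
    rw [SeriesConvergesTo, tendsto_subtype_rng]
    simp [inClosedSpan]
  obtain ⟨c, hc, -⟩ := hy v
  refine ⟨fun n => c (φ (π n)), (hcoe _).2 ?_, fun b hb => ?_⟩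
  · have hsupp : ∀ n ∉ Set.range φ, c n = 0 := by
      intro n hn
      rw [← he c v hc n]
      -- A coordinate outside the range of `φ` kills every `y (φ k)`, and its kernel is closed.
      have hle : closedSpan (fun k => y (φ k)) ≤ (e n).ker := by
        refine Submodule.topologicalClosure_minimal _ ?_ (e n).isClosed_ker
        rw [Submodule.span_le]
        rintro _ ⟨k, rfl⟩
        have : φ k ≠ n := fun hk => hn ⟨k, hk⟩
        simp [he1, this]
      exact hle v.2
    have hs := (h c ⟨v, hc⟩ hsupp)
    have hv : HasSum (fun n => c n • y n) (v : X) := by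
      have := hs.hasSum
      rwa [tendsto_nhds_unique this.tendsto_sum_nat hc] at this
    have hv' : HasSum ((fun n => c n • y n) ∘ fun n => φ (π n)) (v : X) := by
      refine ((hφ.injective.comp π.injective).hasSum_iff ?_).2 hv
      intro n hn
      rw [hsupp n, zero_smul]
      rintro ⟨k, rfl⟩
      exact hn ⟨π.symm k, by simp⟩
    exact hv'.tendsto_sum_nat
  · ext m
    replace hb := (hcoe b).1 hb
    have h1 := ((e (φ (π m))).continuous.tendsto _).comp hb
    have h2 : Tendsto (fun N => e (φ (π m)) (∑ n ∈ Finset.range N, b n • y (φ (π n)))) atTop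
        (𝓝 (b m)) := by
      refine tendsto_const_nhds.congr' ?_
      filter_upwards [eventually_gt_atTop m] with N hN
      simp [he1, hN, hφ.injective.eq_iff]
    rw [← he c v hc]
    exact tendsto_nhds_unique h2 h1

end Banach

/-! ### Baire category: continuity on a comeager set and splicing. -/

section Baire

/-- A Borel function into a second countable space is continuous on a residual set. -/
theorem Measurable.exists_residual_continuousOn {α β : Type*} [TopologicalSpace α]
    [MeasurableSpace α] [BorelSpace α] [TopologicalSpace β] [SecondCountableTopology β]
    [MeasurableSpace β] [OpensMeasurableSpace β] {f : α → β} (hf : Measurable f) :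
    ∃ G ∈ residual α, ContinuousOn f G := by
  obtain ⟨b, hbc, -, hb⟩ := TopologicalSpace.exists_countable_basis β
  have h : ∀ V : b, ∃ u : Set α, IsOpen u ∧ f ⁻¹' V.1 =ᵇ u := fun V =>
    (hf (hb.isOpen V.2).measurableSet).residualEq_isOpen
  choose u hu hfu using h
  have : Countable b := hbc.to_subtype
  refine ⟨{z | ∀ V : b, z ∈ f ⁻¹' V.1 ↔ z ∈ u V},
    eventually_countable_forall.2 fun V => eventuallyEq_set.1 (hfu V), ?_⟩
  intro z hz
  refine hb.nhds_hasBasis.tendsto_right_iff.2 fun V hV => ?_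
  filter_upwards [mem_nhdsWithin_of_mem_nhds ((hu ⟨V, hV.1⟩).mem_nhds ((hz ⟨V, hV.1⟩).1 hV.2)),
    self_mem_nhdsWithin] with w hw hwG
  exact (hwG ⟨V, hV.1⟩).2 hw

variable {F : ℕ → Type*}

/-- The sequence which is `r` before `k` and `z` from `k` on. -/
def splice (k : ℕ) (r z : ∀ n, F n) : ∀ n, F n := fun i => if i < k then r i else z i

theorem splice_of_lt {k i : ℕ} (h : i < k) (r z : ∀ n, F n) : splice k r z i = r i := if_pos h

theorem splice_of_le {k i : ℕ} (h : k ≤ i) (r z : ∀ n, F n) : splice k r z i = z i :=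
  if_neg (not_lt.2 h)

theorem splice_self (k : ℕ) (z : ∀ n, F n) : splice k z z = z := by
  ext i
  simp [splice]

theorem splice_splice_right (k : ℕ) (r r' z : ∀ n, F n) :
    splice k r (splice k r' z) = splice k r z := by
  ext i
  by_cases h : i < k <;> simp [splice, h]

theorem splice_congr_left {k : ℕ} {r r' : ∀ n, F n} (h : ∀ i < k, r i = r' i) (z : ∀ n, F n) :
    splice k r z = splice k r' z := by
  ext i
  by_cases hi : i < k
  · simp [splice, hi, h i hi]
  · simp [splice, hi]

theorem splice_congr_right {k : ℕ} {z z' : ∀ n, F n} (h : ∀ i ≥ k, z i = z' i) (r : ∀ n, F n) :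
    splice k r z = splice k r z' := by
  ext i
  by_cases hi : i < k
  · simp [splice, hi]
  · simp [splice, hi, h i (not_lt.1 hi)]

/-- Turns "for all prefixes" into a finite conjunction, which residual and neighbourhood filters
respect. -/
theorem exists_finite_prefixes [∀ n, Finite (F n)] [∀ n, Nonempty (F n)] (k : ℕ) :
    ∃ S : Set (∀ n, F n), S.Finite ∧ ∀ r, ∃ s ∈ S, ∀ z, splice k r z = splice k s z := by
  classical
  let d : ∀ n, F n := fun n => Classical.arbitrary _
  let g : (∀ i : Fin k, F i) → ∀ n, F n := fun r n => if h : n < k then r ⟨n, h⟩ else d n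
  refine ⟨Set.range g, Set.finite_range g, fun r => ⟨g fun i => r i, ⟨fun i => r i, rfl⟩, ?_⟩⟩
  exact splice_congr_left fun i hi => by simp [g, hi]

variable [∀ n, TopologicalSpace (F n)]

theorem continuous_splice (k : ℕ) (r : ∀ n, F n) : Continuous (splice k r) := by
  refine continuous_pi fun i => ?_
  by_cases hi : i < k
  · simpa only [splice, if_pos hi] using continuous_const
  · simpa only [splice, if_neg hi] using continuous_apply i

variable [∀ n, DiscreteTopology (F n)]

/-- A point near `splice k r z` already has prefix `r`; giving it the prefix of `z` lands in `O`.
Together with continuity, this makes preimages of residual sets residual. -/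
theorem isOpenMap_splice (k : ℕ) (r : ∀ n, F n) : IsOpenMap (splice k r) := by
  intro O hO
  rw [isOpen_iff_mem_nhds]
  rintro _ ⟨z, hz, rfl⟩
  have h1 : PiNat.cylinder (splice k r z) k ∈ 𝓝 (splice k r z) :=
    (PiNat.isOpen_cylinder _ _ _).mem_nhds (PiNat.self_mem_cylinder _ _)
  have h2 : splice k z ⁻¹' O ∈ 𝓝 (splice k r z) :=
    (hO.preimage (continuous_splice k z)).mem_nhds
      (by rwa [Set.mem_preimage, splice_splice_right, splice_self])
  filter_upwards [h1, h2] with w hw1 hw2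
  refine ⟨_, hw2, ?_⟩
  rw [splice_splice_right]
  have : ∀ i < k, r i = w i := fun i hi => by
    rw [PiNat.mem_cylinder_iff.1 hw1 i hi, splice_of_lt hi]
  rw [splice_congr_left this, splice_self]

theorem exists_cylinder_subset {z : ∀ n, F n} {s : Set (∀ n, F n)} (hs : s ∈ 𝓝 z) (k : ℕ) :
    ∃ l ≥ k, PiNat.cylinder z l ⊆ s := by
  obtain ⟨_, ⟨y, n, rfl⟩, hz, hsub⟩ :=
    (PiNat.isTopologicalBasis_cylinders F).mem_nhds_iff.1 hs
  refine ⟨max n k, le_max_right _ _, (PiNat.cylinder_anti _ (le_max_left _ _)).trans ?_⟩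
  rwa [PiNat.mem_cylinder_iff_eq.1 hz]

variable {X : Type*} [NormedAddCommGroup X] [NormedSpace ℝ X]

/-- The norm of the part of the series `∑ₙ a(n) xₙ` with indices in `[p, q)`. -/
def blockNorm (x : ℕ → X) (a : ℕ → ℝ) (p q : ℕ) : ℝ := ‖∑ n ∈ Finset.Ico p q, a n • x n‖

theorem continuous_blockNorm (x : ℕ → X) (p q : ℕ) : Continuous fun a => blockNorm x a p q := by
  unfold blockNorm
  fun_prop

theorem blockNorm_zero (x : ℕ → X) (p q : ℕ) : blockNorm x 0 p q = 0 := by simp [blockNorm]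

theorem blockNorm_self (x : ℕ → X) (a : ℕ → ℝ) (p : ℕ) : blockNorm x a p p = 0 := by
  simp [blockNorm]

theorem blockNorm_neg (x : ℕ → X) (a : ℕ → ℝ) (p q : ℕ) :
    blockNorm x (-a) p q = blockNorm x a p q := by
  simp [blockNorm]

theorem blockNorm_sub_comm (x : ℕ → X) (a b : ℕ → ℝ) (p q : ℕ) :
    blockNorm x (a - b) p q = blockNorm x (b - a) p q := by
  rw [← blockNorm_neg, neg_sub]

theorem blockNorm_sub_le (x : ℕ → X) (a b c : ℕ → ℝ) (p q : ℕ) :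
    blockNorm x (a - c) p q ≤ blockNorm x (a - b) p q + blockNorm x (b - c) p q := by
  unfold blockNorm
  refine le_trans (le_of_eq ?_) (norm_add_le _ _)
  rw [← Finset.sum_add_distrib]
  congr 1
  refine Finset.sum_congr rfl fun n _ => ?_
  rw [← add_smul]
  simp

theorem blockNorm_le_add (x : ℕ → X) (a : ℕ → ℝ) {p r q : ℕ} (hpr : p ≤ r) (hrq : r ≤ q) :
    blockNorm x a p q ≤ blockNorm x a p r + blockNorm x a r q := by
  unfold blockNorm
  rw [← Finset.sum_Ico_consecutive _ hpr hrq]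
  exact norm_add_le _ _

theorem blockNorm_congr (x : ℕ → X) {a b : ℕ → ℝ} {p q : ℕ}
    (h : ∀ n ∈ Finset.Ico p q, a n = b n) : blockNorm x a p q = blockNorm x b p q := by
  unfold blockNorm
  rw [Finset.sum_congr rfl fun n hn => by rw [h n hn]]

/-! ### Fusion: decoupling the blocks of the output. -/

variable [∀ n, Finite (F n)] [∀ n, Nonempty (F n)]

theorem residual_forall_splice_mem {G : Set (∀ n, F n)} (hG : G ∈ residual _) (k : ℕ) :
    {z | ∀ r, splice k r z ∈ G} ∈ residual (∀ n, F n) := by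
  obtain ⟨S, hS, hrS⟩ := exists_finite_prefixes (F := F) k
  have h : ∀ᶠ z in residual (∀ n, F n), ∀ r ∈ S, splice k r z ∈ G :=
    (eventually_all_finite hS).2 fun r _ =>
      tendsto_residual_of_isOpenMap (continuous_splice k r) (isOpenMap_splice k r) hG
  filter_upwards [h] with z hz r
  obtain ⟨s, hs, hrs⟩ := hrS r
  rw [hrs]
  exact hz s hs

/-- One step of the construction: a finite filling `z₀` on `[k, l)` decides `Θ` up to `ε` on the
first `m` coordinates given the prefix, and makes the tail from `m` on independent of the prefix up
to `ε`. -/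
theorem exists_deciding_filling [CompleteSpace X] {x : ℕ → X} {Θ : (∀ n, F n) → ℕ → ℝ}
    (hE : ∀ z w, (∀ᶠ i in atTop, z i = w i) → Θ z - Θ w ∈ coef x)
    {G : Set (∀ n, F n)} (hG : G ∈ residual _) (hΘ : ContinuousOn Θ G)
    {U : ℕ → Set (∀ n, F n)} (hU : ∀ j, IsOpen (U j)) (hGU : ∀ j, G ⊆ U j)
    (k N J : ℕ) {ε : ℝ} (hε : 0 < ε) :
    ∃ (z₀ : ∀ n, F n) (l m : ℕ), k ≤ l ∧ N < m ∧
      (∀ z, (∀ i, k ≤ i → i < l → z i = z₀ i) → ∀ r, ∀ j ≤ J, splice k r z ∈ U j) ∧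
      (∀ z, (∀ i, k ≤ i → i < l → z i = z₀ i) → (∀ r, splice k r z ∈ G) →
        ∀ r r' p q, m ≤ p → p ≤ q →
          blockNorm x (Θ (splice k r z) - Θ (splice k r' z)) p q ≤ ε) ∧
      (∀ z z', (∀ i, k ≤ i → i < l → z i = z₀ i) → (∀ i, k ≤ i → i < l → z' i = z₀ i) →
        (∀ r, splice k r z ∈ G) → (∀ r, splice k r z' ∈ G) →
        ∀ r p q, p ≤ q → q ≤ m →
          blockNorm x (Θ (splice k r z) - Θ (splice k r z')) p q ≤ ε) := by
  obtain ⟨S, hS, hrS⟩ := exists_finite_prefixes (F := F) k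
  set H : Set (∀ n, F n) := {z | ∀ r, splice k r z ∈ G} with hH
  obtain ⟨t, htH, htG, htd⟩ := mem_residual.1 (residual_forall_splice_mem hG k)
  have hcont : ∀ r, ContinuousOn (fun z => Θ (splice k r z)) H := fun r =>
    hΘ.comp (continuous_splice k r).continuousOn fun z hz => hz r
  -- These sets cover `t`, since finite changes of input stay in one class. As `Θ` is continuous
  -- only on `G`, `A m` need not be closed; Baire is applied to closures and continuity on `H`
  -- recovers the bound.
  let A : ℕ → Set (∀ n, F n) := fun m => {z | z ∈ H ∧ ∀ r r' p q, m ≤ p → p ≤ q →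
    blockNorm x (Θ (splice k r z) - Θ (splice k r' z)) p q ≤ ε}
  have hA : t ⊆ ⋃ m, closure (A m) := by
    intro z hz
    have h : ∀ r ∈ S, ∀ r' ∈ S, ∀ᶠ m in atTop, ∀ p q, m ≤ p → p ≤ q →
        blockNorm x (Θ (splice k r z) - Θ (splice k r' z)) p q ≤ ε := by
      intro r _ r' _
      obtain ⟨M, hM⟩ := mem_coef_iff.1 (hE (splice k r z) (splice k r' z)
        ((eventually_ge_atTop k).mono fun i hi => by rw [splice_of_le hi, splice_of_le hi])) ε hε
      filter_upwards [eventually_ge_atTop M] with m hm p q hp hpq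
      exact (hM p q (hm.trans hp) hpq).le
    obtain ⟨m, hm⟩ := ((eventually_all_finite hS).2 fun r hr =>
      (eventually_all_finite hS).2 fun r' hr' => h r hr r' hr').exists
    refine Set.mem_iUnion.2 ⟨m, subset_closure ⟨htH hz, fun r r' => ?_⟩⟩
    obtain ⟨s, hs, hrs⟩ := hrS r
    obtain ⟨s', hs', hrs'⟩ := hrS r'
    rw [hrs, hrs']
    exact hm s hs s' hs'
  have hdense := htG.dense_iUnion_interior_of_closed htd (fun m => isClosed_closure) hA
  obtain ⟨z₁, hz₁⟩ := hdense.nonempty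
  obtain ⟨m, hm⟩ := Set.mem_iUnion.1 hz₁
  obtain ⟨z₀, hz₀, hz₀t⟩ := htd.inter_open_nonempty _ isOpen_interior ⟨z₁, hm⟩
  have hz₀H : z₀ ∈ H := htH hz₀t
  have htail : ∀ z ∈ H, z ∈ interior (closure (A m)) → ∀ r r' p q, m ≤ p → p ≤ q →
      blockNorm x (Θ (splice k r z) - Θ (splice k r' z)) p q ≤ ε := by
    intro z hz hzA r r' p q hp hpq
    have hc : ContinuousWithinAt
        (fun z => blockNorm x (Θ (splice k r z) - Θ (splice k r' z)) p q) (A m) z :=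
      ((continuous_blockNorm x p q).continuousAt.comp_continuousWithinAt
        ((hcont r z hz).sub (hcont r' z hz))).mono fun w hw => hw.1
    exact hc.closure_le (interior_subset hzA) continuousWithinAt_const
      fun w hw => hw.2 r r' p q hp hpq
  let m' := max m (N + 1)
  -- Half of `ε`, because two fillings are later compared through `z₀`.
  have hhead : ∀ᶠ z in 𝓝[H] z₀, ∀ r ∈ S, ∀ p ∈ Set.Iic m', ∀ q ∈ Set.Iic m',
      blockNorm x (Θ (splice k r z) - Θ (splice k r z₀)) p q < ε / 2 := by
    refine (eventually_all_finite hS).2 fun r _ => (eventually_all_finite (Set.finite_Iic _)).2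
      fun p _ => (eventually_all_finite (Set.finite_Iic _)).2 fun q _ => ?_
    have hc : ContinuousWithinAt
        (fun z => blockNorm x (Θ (splice k r z) - Θ (splice k r z₀)) p q) H z₀ :=
      (continuous_blockNorm x p q).continuousAt.comp_continuousWithinAt
        ((hcont r z₀ hz₀H).sub continuousWithinAt_const)
    refine hc.eventually_lt continuousWithinAt_const ?_
    simpa [blockNorm_zero] using hε
  have hopen : ∀ᶠ z in 𝓝 z₀, ∀ j ∈ Set.Iic J, ∀ r ∈ S, splice k r z ∈ U j :=
    (eventually_all_finite (Set.finite_Iic _)).2 fun j _ => (eventually_all_finite hS).2 fun r _ =>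
      ((hU j).preimage (continuous_splice k r)).mem_nhds (hGU j (hz₀H r))
  obtain ⟨l, hkl, hl⟩ := exists_cylinder_subset (inter_mem (inter_mem
    (isOpen_interior.mem_nhds hz₀) (eventually_nhdsWithin_iff.1 hhead)) hopen) k
  have hcyl : ∀ z, (∀ i, k ≤ i → i < l → z i = z₀ i) →
      splice k z₀ z ∈ PiNat.cylinder z₀ l := by
    intro z hz
    rw [PiNat.mem_cylinder_iff]
    intro i hi
    by_cases hik : i < k
    · rw [splice_of_lt hik]
    · rw [splice_of_le (not_lt.1 hik), hz i (not_lt.1 hik) hi]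
  have hspl : ∀ z, (∀ r, splice k r z ∈ G) → splice k z₀ z ∈ H := fun z hz r => by
    rw [splice_splice_right]
    exact hz r
  refine ⟨z₀, l, m', hkl, by omega, fun z hz r j hj => ?_, fun z hz hzG r r' p q hp hpq => ?_,
    fun z z' hz hz' hzG hzG' r p q hpq hq => ?_⟩
  · obtain ⟨s, hs, hrs⟩ := hrS r
    have := (hl (hcyl z hz)).2 j hj s hs
    rwa [splice_splice_right, ← hrs] at this
  · have := htail _ (hspl z hzG) (hl (hcyl z hz)).1.1 r r' p q (le_trans (le_max_left _ _) hp) hpq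
    rwa [splice_splice_right, splice_splice_right] at this
  · obtain ⟨s, hs, hrs⟩ := hrS r
    have h1 := (hl (hcyl z hz)).1.2 (hspl z hzG) s hs p (hpq.trans hq) q hq
    have h2 := (hl (hcyl z' hz')).1.2 (hspl z' hzG') s hs p (hpq.trans hq) q hq
    rw [splice_splice_right] at h1 h2
    rw [hrs, hrs]
    refine (blockNorm_sub_le x _ (Θ (splice k s z₀)) _ p q).trans ?_
    rw [blockNorm_sub_comm x (Θ (splice k s z₀))]
    linarith

/-- On a suitable set of sequences with free coordinates `φ i`, the `i`-th block of `Θ` depends,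
up to a small error, only on the coordinate `φ i`. -/
theorem exists_block_decomposition [CompleteSpace X] {x : ℕ → X} {Θ : (∀ n, F n) → ℕ → ℝ}
    (hE : ∀ z w, (∀ᶠ i in atTop, z i = w i) → Θ z - Θ w ∈ coef x)
    {G : Set (∀ n, F n)} (hG : G ∈ residual _) (hΘ : ContinuousOn Θ G) :
    ∃ φ m : ℕ → ℕ, StrictMono φ ∧ StrictMono m ∧ ∃ s : ∀ n, F n, ∀ w w' : ∀ n, F n,
      (∀ n ∉ Set.range φ, w n = s n) → (∀ n ∉ Set.range φ, w' n = s n) →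
      ∀ i, w (φ i) = w' (φ i) → ∀ p q, m i ≤ p → p ≤ q → q ≤ m (i + 1) →
        blockNorm x (Θ w - Θ w') p q ≤ 2 * (1 / 2) ^ i := by
  obtain ⟨t, htG, htδ, htd⟩ := mem_residual.1 hG
  have ht : t ∈ residual _ := residual_of_dense_Gδ htδ htd
  obtain ⟨U, hU, rfl⟩ := isGδ_iff_eq_iInter_nat.1 htδ
  have hpow : ∀ i : ℕ, (0 : ℝ) < (1 / 2) ^ i := fun i => by positivity
  choose z₀ l m hkl hNm hopen htail hhead using fun k N i : ℕ =>
    exists_deciding_filling hE ht (hΘ.mono htG) hU (fun j => Set.iInter_subset U j) k N i (hpow i)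
  -- The state is (start of the next filling, output cut reached). A filling ends just before `l`;
  -- coordinate `l` is left free, so the next one starts at `l + 1`.
  let st : ℕ → ℕ × ℕ := fun i => Nat.rec (1, 0) (fun i s => (l s.1 s.2 i + 1, m s.1 s.2 i)) i
  let K : ℕ → ℕ := fun i => (st i).1
  let φ : ℕ → ℕ := fun i => l (st i).1 (st i).2 i
  let M : ℕ → ℕ := fun i => m (st i).1 (st i).2 i
  let ζ : ℕ → ∀ n, F n := fun i => z₀ (st i).1 (st i).2 i
  have hKφ : ∀ i, K i ≤ φ i := fun i => hkl _ _ _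
  have hK : ∀ i, K (i + 1) = φ i + 1 := fun i => rfl
  have hKmono : StrictMono K := strictMono_nat_of_lt_succ fun i => by
    rw [hK]; exact Nat.lt_succ_of_le (hKφ i)
  have hφmono : StrictMono φ := strictMono_nat_of_lt_succ fun i => by
    have := hKφ (i + 1)
    rw [hK] at this
    exact this
  have hMmono : StrictMono M := strictMono_nat_of_lt_succ fun i => hNm _ (M i) (i + 1)
  obtain ⟨β, hβ⟩ := exists_blockIndex hKmono
  have hfill : ∀ w : ∀ n, F n, (∀ n ∉ Set.range φ, w n = ζ (β n) n) →
      ∀ i n, K i ≤ n → n < φ i → w n = ζ i n := by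
    intro w hw i n hKn hn
    have hβn : β n = i := hβ n i (by rw [Finset.mem_Ico, hK]; omega)
    rw [hw n, hβn]
    rintro ⟨j, rfl⟩
    have : β (φ j) = j := hβ _ _ (by rw [Finset.mem_Ico, hK]; exact ⟨hKφ j, by omega⟩)
    rw [← this, hβn] at hn
    exact lt_irrefl _ (hn.trans_eq (by rw [← hβn, this]))
  have hmem : ∀ w : ∀ n, F n, (∀ n ∉ Set.range φ, w n = ζ (β n) n) →
      ∀ i r, splice (K i) r w ∈ ⋂ j, U j := by
    intro w hw i r
    refine Set.mem_iInter.2 fun j => ?_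
    -- Stage `max i j` forces membership in `U j` for any prefix, and it lies beyond the prefix
    -- changed here.
    have h := hopen _ _ (max i j) w (hfill w hw (max i j)) (splice (K i) r w) j (le_max_right _ _)
    rwa [splice_congr_right (z' := splice (K i) r w), splice_self] at h
    intro n hn
    rw [splice_of_le ((hKmono.monotone (le_max_left i j)).trans hn)]
  refine ⟨φ, M, hφmono, hMmono, fun n => ζ (β n) n, fun w w' hw hw' i hi p q hp hpq hq => ?_⟩
  -- The intermediate point is `w` before `K (i + 1)` and `w'` after. It shares a prefix with `w`,
  -- so stage `i + 1` controls the output before `M (i + 1)`. It agrees with `w'` from `K i` on, so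
  -- stage `i` controls the output after `M i`.
  have h1 := hhead _ _ (i + 1) w w' (hfill w hw (i + 1)) (hfill w' hw' (i + 1))
    (hmem w hw (i + 1)) (hmem w' hw' (i + 1)) w p q hpq hq
  have h2 := htail _ _ i w' (hfill w' hw' i) (hmem w' hw' i) (splice (K (i + 1)) w w') w' p q hp hpq
  rw [splice_self] at h1
  rw [splice_self, splice_congr_right (z' := splice (K (i + 1)) w w'), splice_self] at h2
  · refine (blockNorm_sub_le x _ (Θ (splice (K (i + 1)) w w')) _ p q).trans
      ((add_le_add h1 h2).trans ?_)
    have := hpow i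
    rw [pow_succ]
    linarith
  · intro n hn
    rcases lt_trichotomy n (φ i) with h | h | h
    · rw [splice_of_lt (by rw [hK]; omega), hfill w hw i n hn h, hfill w' hw' i n hn h]
    · rw [h, splice_of_lt (by rw [hK]; omega), hi]
    · rw [splice_of_le (by rw [hK]; omega)]

/-- Geometrically small blocks add up to a convergent series. -/
theorem mem_coef_of_blockNorm_le [CompleteSpace X] {x : ℕ → X} {a : ℕ → ℝ} {m : ℕ → ℕ}
    (hm : StrictMono m) (h : ∀ i p q, m i ≤ p → p ≤ q → q ≤ m (i + 1) →
      blockNorm x a p q ≤ 2 * (1 / 2) ^ i) : a ∈ coef x := by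
  -- The bound is the geometric sum of `2 * (1 / 2) ^ i` over `I ≤ i < j`.
  have key : ∀ I j, I ≤ j → ∀ p q, m I ≤ p → p ≤ q → q ≤ m j →
      blockNorm x a p q ≤ 4 * ((1 / 2) ^ I - (1 / 2) ^ j) := by
    intro I j hIj
    induction j, hIj using Nat.le_induction with
    | base =>
      intro p q hp hpq hq
      obtain rfl : p = q := by omega
      simp [blockNorm_self]
    | succ j hIj ih =>
      intro p q hp hpq hq
      have hpow : ((1 : ℝ) / 2) ^ (j + 1) = (1 / 2) ^ j * (1 / 2) := pow_succ _ _
      have hpos : (0 : ℝ) < (1 / 2) ^ j := by positivity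
      have hle : ((1 : ℝ) / 2) ^ j ≤ (1 / 2) ^ I :=
        pow_le_pow_of_le_one (by norm_num) (by norm_num) hIj
      rcases le_total q (m j) with hqj | hqj
      · have := ih p q hp hpq hqj
        linarith
      rcases le_total p (m j) with hpj | hpj
      · have h1 := ih p (m j) hp hpj le_rfl
        have h2 := h j (m j) q le_rfl hqj hq
        have := blockNorm_le_add x a hpj hqj
        linarith
      · have := h j p q hpj hpq hq
        linarith
  rw [mem_coef_iff]
  intro ε hε
  obtain ⟨I, hI⟩ := exists_pow_lt_of_lt_one (show 0 < ε / 4 by positivity)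
    (show (1 / 2 : ℝ) < 1 by norm_num)
  refine ⟨m I, fun p q hp hpq => ?_⟩
  have h1 := key I (max I q) (le_max_left _ _) p q hp hpq
    ((le_max_right I q).trans (hm.id_le _))
  have : (0 : ℝ) < (1 / 2) ^ (max I q) := by positivity
  change blockNorm x a p q < ε
  linarith

/-- Coordinatewise mixing along `A` of two points with `Θ`-values congruent modulo `coef x`
preserves congruence, when `x` is an unconditional basis. -/
theorem exists_mixing_subsequence [CompleteSpace X] {x : ℕ → X}
    (hx : IsUnconditionalBasisOfSpace x) {Θ : (∀ n, F n) → ℕ → ℝ}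
    (hE : ∀ z w, (∀ᶠ i in atTop, z i = w i) → Θ z - Θ w ∈ coef x)
    {G : Set (∀ n, F n)} (hG : G ∈ residual _) (hΘ : ContinuousOn Θ G) :
    ∃ φ : ℕ → ℕ, StrictMono φ ∧ ∃ s : ∀ n, F n, ∀ w w' : ∀ n, F n,
      (∀ n ∉ Set.range φ, w n = s n) → (∀ n ∉ Set.range φ, w' n = s n) →
      Θ w - Θ w' ∈ coef x → ∀ v : ∀ n, F n, ∀ A : Set ℕ,
        (∀ n ∈ A, v n = w n) → (∀ n ∉ A, v n = w' n) → Θ v - Θ w' ∈ coef x := by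
  obtain ⟨φ, m, hφ, hm, s, h⟩ := exists_block_decomposition hE hG hΘ
  obtain ⟨β, hβ⟩ := exists_blockIndex hm
  refine ⟨φ, hφ, s, fun w w' hw hw' hww' v A hvA hvA' => ?_⟩
  have hv : ∀ n ∉ Set.range φ, v n = s n := by
    intro n hn
    by_cases hA : n ∈ A
    · rw [hvA n hA, hw n hn]
    · rw [hvA' n hA, hw' n hn]
  -- The union of output blocks whose free input coordinate lies in `A`; there `Θ v` is close to `Θ
  -- w`, and on the other blocks to `Θ w'`.
  let B : Set ℕ := {n | φ (β n) ∈ A}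
  have h1 : B.indicator (Θ w - Θ w') ∈ coef x := hx.indicator_mem_coef hww' B
  have h2 : Θ v - Θ w' - B.indicator (Θ w - Θ w') ∈ coef x := by
    refine mem_coef_of_blockNorm_le hm fun i p q hp hpq hq => ?_
    have hβi : ∀ n ∈ Finset.Ico p q, β n = i := fun n hn =>
      hβ n i (Finset.Ico_subset_Ico hp hq hn)
    by_cases hA : φ i ∈ A
    · rw [blockNorm_congr x (b := Θ v - Θ w)]
      · exact h v w hv hw i (hvA _ hA) p q hp hpq hq
      · intro n hn
        have : n ∈ B := by rwa [← hβi n hn] at hA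
        simp [this]
    · rw [blockNorm_congr x (b := Θ v - Θ w')]
      · exact h v w' hv hw' i (hvA' _ hA) p q hp hpq hq
      · intro n hn
        have : n ∉ B := by rwa [← hβi n hn] at hA
        simp [this]
  simpa using (coef x).add_mem h2 h1

end Baire

/-! ### Approximating coefficients by finite grids. -/

section Rounding

variable {Y : Type*} [NormedAddCommGroup Y]

/-- Mesh of the `n`-th grid. -/
noncomputable def gridMesh (y : ℕ → Y) (n : ℕ) : ℝ := (1 / 2) ^ n / ‖y n‖

/-- The point of `ℝ^ℕ` with the given grid coordinates. -/
noncomputable def gridPoint (y : ℕ → Y) (z : ∀ n : ℕ, Fin (2 ^ n + 1)) (n : ℕ) : ℝ :=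
  ((z n : ℕ) : ℝ) * gridMesh y n

theorem continuous_gridPoint (y : ℕ → Y) : Continuous (gridPoint y) := by
  refine continuous_pi fun n => ?_
  exact ((continuous_of_discreteTopology
    (f := fun t : Fin (2 ^ n + 1) => ((t : ℕ) : ℝ))).comp (continuous_apply n)).mul continuous_const

variable [NormedSpace ℝ Y]

theorem gridPoint_sub_mem_coef (y : ℕ → Y) {z w : ∀ n : ℕ, Fin (2 ^ n + 1)}
    (h : ∀ᶠ i in atTop, z i = w i) : gridPoint y z - gridPoint y w ∈ coef y := by
  obtain ⟨N, hN⟩ := eventually_atTop.1 h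
  refine mem_coef_of_summable (summable_of_ne_finset_zero (s := Finset.range N) fun n hn => ?_)
  simp [gridPoint, hN n (by simpa using hn)]

theorem tendsto_smul_of_mem_coef {y : ℕ → Y} {c : ℕ → ℝ} (hc : c ∈ coef y) :
    Tendsto (fun n => c n • y n) atTop (𝓝 0) := by
  obtain ⟨v, hv⟩ := hc
  have h := (hv.comp (tendsto_add_atTop_nat 1)).sub hv
  simpa [Function.comp_def, Finset.sum_range_succ] using h

/-- Every coefficient sequence supported in `R` is, up to an absolutely convergent series, the
difference of two grid points that take prescribed values off `R`. -/
theorem exists_gridPoint_sub_approx [CompleteSpace Y] {y : ℕ → Y} (hy : ∀ n, y n ≠ 0)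
    {c : ℕ → ℝ} (hc : c ∈ coef y) {R : Set ℕ} (hR : ∀ n ∉ R, c n = 0)
    (s : ∀ n : ℕ, Fin (2 ^ n + 1)) :
    ∃ w w' : ∀ n : ℕ, Fin (2 ^ n + 1), (∀ n ∉ R, w n = s n) ∧ (∀ n ∉ R, w' n = s n) ∧
      Summable fun n => (c n - (gridPoint y w n - gridPoint y w' n)) • y n := by
  classical
  have hδ : ∀ n, 0 < gridMesh y n := fun n =>
    div_pos (by positivity) (norm_pos_iff.2 (hy n))
  -- The minimum only ensures the value fits in `Fin`. It is eventually inactive: `‖c n • y n‖ < 1`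
  -- means `|c n|` is below `2 ^ n` meshes.
  let d : ∀ n : ℕ, Fin (2 ^ n + 1) := fun n =>
    ⟨min ⌊|c n| / gridMesh y n⌋₊ (2 ^ n), by omega⟩
  -- Grid points are nonnegative, so the sign of `c n` decides which of the two carries the rounded
  -- value.
  refine ⟨fun n => if n ∈ R then (if 0 ≤ c n then d n else 0) else s n,
    fun n => if n ∈ R then (if 0 ≤ c n then 0 else d n) else s n,
    fun n hn => by simp [hn], fun n hn => by simp [hn], ?_⟩
  refine Summable.of_norm_bounded_eventually_nat (g := fun n => (1 / 2 : ℝ) ^ n)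
    (summable_geometric_of_lt_one (by norm_num) (by norm_num)) ?_
  have hsmall : ∀ᶠ n in atTop, ‖c n • y n‖ < 1 :=
    (tendsto_smul_of_mem_coef hc).norm.eventually_lt_const (by simp)
  filter_upwards [hsmall] with n hn
  by_cases hnR : n ∈ R
  swap
  · simp [gridPoint, hnR, hR n hnR]
  have hny : 0 < ‖y n‖ := norm_pos_iff.2 (hy n)
  have hq : |c n| / gridMesh y n ≤ 2 ^ n := by
    rw [norm_smul, Real.norm_eq_abs] at hn
    rw [gridMesh, div_div_eq_mul_div, div_le_iff₀ (by positivity), ← mul_pow]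
    simpa using hn.le
  have hfl : ⌊|c n| / gridMesh y n⌋₊ ≤ 2 ^ n := by
    rw [← Nat.floor_natCast (R := ℝ) (2 ^ n)]
    exact Nat.floor_le_floor (by push_cast; exact hq)
  have hd : ((d n : ℕ) : ℝ) = ⌊|c n| / gridMesh y n⌋₊ := by simp only [d, min_eq_left hfl]
  have h1 : ((d n : ℕ) : ℝ) * gridMesh y n ≤ |c n| := by
    rw [hd, ← le_div_iff₀ (hδ n)]
    exact Nat.floor_le (div_nonneg (abs_nonneg _) (hδ n).le)
  have h2 : |c n| ≤ ((d n : ℕ) : ℝ) * gridMesh y n + gridMesh y n := by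
    have := (Nat.lt_floor_add_one (|c n| / gridMesh y n)).le
    rw [← hd, div_le_iff₀ (hδ n)] at this
    linarith
  have hmesh : gridMesh y n * ‖y n‖ = (1 / 2) ^ n := div_mul_cancel₀ _ hny.ne'
  rw [norm_smul, ← hmesh]
  refine mul_le_mul_of_nonneg_right ?_ hny.le
  rw [Real.norm_eq_abs, abs_le]
  by_cases hcn : 0 ≤ c n
  · rw [abs_of_nonneg hcn] at h1 h2
    simp only [gridPoint, hnR, hcn, if_true, Fin.val_zero, Nat.cast_zero, zero_mul, sub_zero]
    constructor <;> linarith [hδ n]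
  · rw [abs_of_neg (not_le.1 hcn)] at h1 h2
    simp only [gridPoint, hnR, hcn, if_true, if_false, Fin.val_zero, Nat.cast_zero, zero_mul,
      zero_sub]
    constructor <;> linarith [hδ n]

end Rounding

/-! ### Conclusion. -/

theorem theorem4p4
    {X : Type*} [NormedAddCommGroup X] [NormedSpace ℝ X] [CompleteSpace X]
    {Y : Type*} [NormedAddCommGroup Y] [NormedSpace ℝ Y] [CompleteSpace Y]
    (x : ℕ → X) (y : ℕ → Y)
    (hx : IsUnconditionalBasisOfSpace x)
    (hy : IsBasisOfSpace y)
    (hsub : ∀ φ : ℕ → ℕ, StrictMono φ → ¬ IsUnconditionalBasicSeq (fun k => y (φ k))) :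
    ¬ BorelReducible (schauderEquiv y) (schauderEquiv x) := by
  rintro ⟨θ, hθ, hred⟩
  replace hred : ∀ a b, a - b ∈ coef y ↔ θ a - θ b ∈ coef x := hred
  obtain ⟨G, hG, hGc⟩ :=
    (hθ.comp (continuous_gridPoint y).measurable).exists_residual_continuousOn
  obtain ⟨φ, hφ, s, h⟩ := exists_mixing_subsequence hx
    (fun z w hzw => (hred _ _).1 (gridPoint_sub_mem_coef y hzw)) hG hGc
  refine hsub φ hφ (hy.isUnconditionalBasicSeq_comp hφ fun c hc hcφ => ?_)
  obtain ⟨w, w', hw, hw', hsum⟩ := exists_gridPoint_sub_approx hy.ne_zero hc hcφ s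
  refine summable_of_forall_indicator_mem_coef fun A => ?_
  classical
  let v : ∀ n : ℕ, Fin (2 ^ n + 1) := fun n => if n ∈ A then w n else w' n
  have hww' : gridPoint y w - gridPoint y w' ∈ coef y := by
    have h1 : c - (gridPoint y w - gridPoint y w') ∈ coef y := mem_coef_of_summable hsum
    simpa using (coef y).sub_mem hc h1
  have hv : gridPoint y v - gridPoint y w' ∈ coef y :=
    (hred _ _).2 (h w w' hw hw' ((hred _ _).1 hww') v A
      (fun n hn => if_pos hn) (fun n hn => if_neg hn))
  -- On `A` the difference for `v` is that of `w` and `w'`, off `A` it vanishes. So `A.indicator c`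
  -- is this rounding error plus the difference for `v`.
  have hsumA : A.indicator (c - (gridPoint y w - gridPoint y w')) ∈ coef y := by
    refine mem_coef_of_summable ((hsum.indicator A).congr fun n => ?_)
    by_cases hn : n ∈ A <;> simp [hn]
  convert (coef y).add_mem hsumA hv using 1
  ext n
  by_cases hn : n ∈ A <;> simp [hn, v, gridPoint]
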